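/- Let $n\ge 1$, let $x,y\in M_n(\mathbb C)$ be Hermitian and put $u(t)=e^{itx}e^{iy}$. Suppose that $\|u(t)-1\|<\sqrt2$ (operator norm) for all $t\in[0,t_0]$. Let $e^{i\theta_1(t)},\dots,e^{i\theta_n(t)}$ be the eigenvalues of $u(t)$, repeated according to multiplicity, with principal arguments $\theta_k(t)\in(-\pi,\pi]$ ordered as $\theta_1(t)\ge\theta_2(t)\ge\dots\ge\theta_n(t)$. Let $\sigma_1(t)\ge\dots\ge\sigma_n(t)\ge 0$ be the singular values of $-i\log u(t)$, where $\log$ is the principal branch of the logarithm. Then for every $1\le m\le n$, on $[0,t_0]$, 1. $t\mapsto\sum_{i=1}^m\theta_i(t)$ is convex, 2. $t\mapsto\sum_{i=m}^n\theta_i(t)$ is concave, 3. $t\mapsto\sum_{i=1}^m\sigma_i(t)$ is convex. Eigenvalues of $u(t)$ may be repeated. The bound $\sqrt2$ is optimal, already for $n=2$: for every $r>\sqrt2$ there are Hermitian $x,y\in M_2(\mathbb C)$ and $t_0>0$ such that $\|u(t)-1\|<r$ for all $t\in[0,t_0]$, and yet on $[0,t_0]$ the function $\theta_1$ is not convex,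 $\theta_2$ is not concave and $\sigma_1$ is not convex. -/

import Mathlib

open scoped Matrix.Norms.L2Operator

noncomputable section

namespace UnitarySegment

variable {n : ℕ}

/-- The segment `u(t) = e^{itx} e^{iy}`. -/
def segment (x y : Matrix (Fin n) (Fin n) ℂ) (t : ℝ) : Matrix (Fin n) (Fin n) ℂ :=
  NormedSpace.exp ((Complex.I * (t : ℂ)) • x) * NormedSpace.exp (Complex.I • y)

/-- The arguments, in `(-π, π]`, of the eigenvalues of `u` (the roots of the characteristic
polynomial, each repeated according to its multiplicity), as a nonincreasing list. -/
def eigenAngleList (u : Matrix (Fin n) (Fin n) ℂ) : List ℝ :=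
  (u.charpoly.roots.map Complex.arg).sort (fun a b => a ≥ b)

theorem length_eigenAngleList (u : Matrix (Fin n) (Fin n) ℂ) :
    (eigenAngleList u).length = n := by
  rw [eigenAngleList, Multiset.length_sort, Multiset.card_map,
    IsAlgClosed.card_roots_eq_natDegree, Matrix.charpoly_natDegree_eq_dim, Fintype.card_fin]

/-- The `i`-th largest eigenvalue angle of `u`; `i = 0` is the largest one. The list of angles has
length `n`, so for `i : Fin n` the default value `0` is never used. -/
def eigenAngle (u : Matrix (Fin n) (Fin n) ℂ) (i : Fin n) : ℝ :=
  (eigenAngleList u).getD i 0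

/-- The matrix `-i log u`, where `log` is the principal branch of the logarithm, applied to the
normal matrix `u` through the functional calculus. -/
def negILog (u : Matrix (Fin n) (Fin n) ℂ) : Matrix (Fin n) (Fin n) ℂ :=
  (-Complex.I) • cfc Complex.log u

/-- The `i`-th largest singular value of a matrix acting on the Euclidean space `ℂⁿ`; `i = 0` is
the largest one. -/
def singVal (a : Matrix (Fin n) (Fin n) ℂ) (i : Fin n) : ℝ :=
  (Matrix.toEuclideanLin a).singularValues i

end UnitarySegment

end

/-! The core is a subadditivity, `sum_mul_eigenAngle_mul_le`: if the angles of the unitaries U and V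
are below π/2 in modulus, then ∑ u_j θ_j(UV) ≤ ∑ u_j θ_j(U) + ∑ u_j θ_j(V) for nonincreasing weights
u. Multiply V by U in N+1 equal factors R, with R^(N+1) = U. Pairing W = R*(RW) with an eigenvector
of RW shows that its angle is, up to O(1/N²), an average of the angles of W plus an average of those
of R. The averages over all eigenvectors form doubly stochastic matrices, so Birkhoff and
rearrangement give the inequality for one factor, and the errors add up to O(1/N). A numerical range
argument keeps the angles of all partial products away from ±π.

Now u(t)² = (u(t)e^{-isx}) u(t+s), the first factor is conjugate to u(t-s), and ‖u-1‖ < √2 puts the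
angles of u below π/2, so those of u² are doubled without wrapping. Subadditivity becomes midpoint
convexity of ∑ u_j θ_j(t); applied to e^{isx} u(t) it also gives continuity. Indicator weights yield
the two claims on angles; sums of largest singular values are maxima of such weighted sums. The
bound is sharp because of a path in SU(2) with angles ±arccos(-cos t sin a), a small. -/

noncomputable section

namespace UnitarySegment

variable {n : ℕ}

/-! ### Eigenvectors and functional calculus. -/

theorem toEuclideanLin_mul_apply (A B : Matrix (Fin n) (Fin n) ℂ) (v : EuclideanSpace ℂ (Fin n)) :
    Matrix.toEuclideanLin (A * B) v = Matrix.toEuclideanLin A (Matrix.toEuclideanLin B v) := by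
  simp [Matrix.toEuclideanLin]

theorem toEuclideanLin_one_apply (v : EuclideanSpace ℂ (Fin n)) :
    Matrix.toEuclideanLin (1 : Matrix (Fin n) (Fin n) ℂ) v = v := by
  simp [Matrix.toEuclideanLin]

theorem toEuclideanLin_aeval (A : Matrix (Fin n) (Fin n) ℂ) (p : Polynomial ℂ) :
    Matrix.toEuclideanLin (Polynomial.aeval A p) =
      Polynomial.aeval (R := ℂ) (A := Module.End ℂ (EuclideanSpace ℂ (Fin n)))
        (Matrix.toEuclideanLin A) p :=
  (Polynomial.aeval_algHom_apply (Matrix.toLpLinAlgEquiv (n := Fin n) (R := ℂ) 2) A p).symm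

theorem mem_spectrum_of_eigenvector {A : Matrix (Fin n) (Fin n) ℂ}
    {v : EuclideanSpace ℂ (Fin n)} {z : ℂ} (hv : Matrix.toEuclideanLin A v = z • v)
    (h0 : v ≠ 0) : z ∈ spectrum ℂ A := by
  rw [← Matrix.spectrum_toLpLin 2]
  exact Module.End.hasEigenvalue_iff_mem_spectrum.1
    (Module.End.hasEigenvalue_of_hasEigenvector
      (Module.End.hasEigenvector_iff.2 ⟨Module.End.mem_eigenspace_iff.2 hv, h0⟩))

/-- The spectrum is finite, so `cfc f U` is the value at `U` of a Lagrange interpolation polynomial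
of `f`. -/
theorem cfc_apply_eigenvector (U : Matrix (Fin n) (Fin n) ℂ) (hU : IsStarNormal U) (f : ℂ → ℂ)
    {v : EuclideanSpace ℂ (Fin n)} {z : ℂ} (hv : Matrix.toEuclideanLin U v = z • v) :
    Matrix.toEuclideanLin (cfc f U) v = f z • v := by
  classical
  rcases eq_or_ne v 0 with rfl | h0
  · simp
  have hz : z ∈ spectrum ℂ U := mem_spectrum_of_eigenvector hv h0
  set S : Finset ℂ := (Matrix.finite_spectrum U).toFinset
  set p : Polynomial ℂ := Lagrange.interpolate S id f
  have hp : ∀ w ∈ spectrum ℂ U, p.eval w = f w := fun w hw =>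
    Lagrange.eval_interpolate_at_node (v := id) f Function.injective_id.injOn
      ((Matrix.finite_spectrum U).mem_toFinset.2 hw)
  have h1 : cfc f U = Polynomial.aeval U p := by
    rw [← cfc_polynomial p U]
    exact cfc_congr fun w hw => (hp w hw).symm
  rw [h1, toEuclideanLin_aeval, ← hp z hz]
  exact Module.End.aeval_apply_of_hasEigenvector
    (Module.End.hasEigenvector_iff.2 ⟨Module.End.mem_eigenspace_iff.2 hv, h0⟩)

/-- The orthonormal basis `v` consists of eigenvectors of `A`, with eigenvalues `c`. -/
def IsEigenbasis (A : Matrix (Fin n) (Fin n) ℂ)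
    (v : OrthonormalBasis (Fin n) ℂ (EuclideanSpace ℂ (Fin n))) (c : Fin n → ℂ) : Prop :=
  ∀ j, Matrix.toEuclideanLin A (v j) = c j • v j

theorem charpoly_of_eigenbasis (T : EuclideanSpace ℂ (Fin n) →ₗ[ℂ] EuclideanSpace ℂ (Fin n))
    (v : OrthonormalBasis (Fin n) ℂ (EuclideanSpace ℂ (Fin n))) (c : Fin n → ℂ)
    (h : ∀ j, T (v j) = c j • v j) :
    T.charpoly = ∏ j, (Polynomial.X - Polynomial.C (c j)) := by
  rw [← LinearMap.charpoly_toMatrix T v.toBasis, ← Matrix.charpoly_diagonal]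
  congr 1
  ext i j
  rw [LinearMap.toMatrix_apply]
  simp only [h, OrthonormalBasis.coe_toBasis, map_smul, OrthonormalBasis.coe_toBasis_repr_apply,
    Matrix.diagonal_apply, OrthonormalBasis.repr_self, PiLp.single_apply,
    Finsupp.smul_apply, smul_eq_mul, mul_ite, mul_one, mul_zero]
  split_ifs with h1
  · rw [h1]
  · rfl

theorem IsEigenbasis.charpoly_roots {A : Matrix (Fin n) (Fin n) ℂ}
    {v : OrthonormalBasis (Fin n) ℂ (EuclideanSpace ℂ (Fin n))} {c : Fin n → ℂ}
    (h : IsEigenbasis A v c) : A.charpoly.roots = Finset.univ.val.map c := by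
  have h1 : A.charpoly = (Matrix.toEuclideanLin A).charpoly := by
    rw [Matrix.toEuclideanLin, Matrix.toLpLin_eq_toLin, Matrix.charpoly_toLin]
  rw [h1, charpoly_of_eigenbasis _ v c h]
  exact (congrArg Polynomial.roots (by rw [Multiset.map_map]; rfl)).trans
    (Polynomial.roots_multiset_prod_X_sub_C (Finset.univ.val.map c))

/-! ### Sorted angles and diagonalization of unitaries. -/

theorem eq_of_antitone_of_map_eq {f g : Fin n → ℝ} (hf : Antitone f) (hg : Antitone g)
    (h : Finset.univ.val.map f = Finset.univ.val.map g) : f = g := by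
  apply List.ofFn_injective
  refine List.Perm.eq_of_pairwise (le := (· ≥ ·)) (fun a b _ _ h1 h2 => le_antisymm h2 h1) ?_ ?_ ?_
  · exact hf.sortedGE_ofFn.pairwise
  · exact hg.sortedGE_ofFn.pairwise
  · rw [← Multiset.coe_eq_coe]
    simpa [Fin.univ_val_map] using h

theorem ofFn_eigenAngle (U : Matrix (Fin n) (Fin n) ℂ) :
    List.ofFn (eigenAngle U) = eigenAngleList U := by
  refine List.ext_getElem (by simp [length_eigenAngleList]) fun i h1 h2 => ?_
  simp [eigenAngle, List.getElem?_eq_getElem h2]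

theorem eigenAngle_antitone (U : Matrix (Fin n) (Fin n) ℂ) : Antitone (eigenAngle U) := by
  rw [← List.sortedGE_ofFn_iff, ofFn_eigenAngle]
  exact (Multiset.pairwise_sort _ _).sortedGE

theorem map_eigenAngle (U : Matrix (Fin n) (Fin n) ℂ) :
    Finset.univ.val.map (eigenAngle U) = U.charpoly.roots.map Complex.arg := by
  rw [Fin.univ_val_map, ofFn_eigenAngle, eigenAngleList, Multiset.sort_eq]

theorem eigenAngle_congr {U V : Matrix (Fin n) (Fin n) ℂ} (h : U.charpoly = V.charpoly) :
    eigenAngle U = eigenAngle V := by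
  ext i
  simp only [eigenAngle, eigenAngleList, h]

theorem eigenAngle_mem (U : Matrix (Fin n) (Fin n) ℂ) (i : Fin n) :
    eigenAngle U i ∈ Set.Ioc (-Real.pi) Real.pi := by
  have : eigenAngle U i ∈ U.charpoly.roots.map Complex.arg := by
    rw [← map_eigenAngle]
    exact Multiset.mem_map_of_mem _ (Finset.mem_univ i)
  obtain ⟨z, -, hz⟩ := Multiset.mem_map.1 this
  rw [← hz]
  exact Complex.arg_mem_Ioc z

theorem IsEigenbasis.eigenAngle_eq {U : Matrix (Fin n) (Fin n) ℂ}
    {v : OrthonormalBasis (Fin n) ℂ (EuclideanSpace ℂ (Fin n))} {θ : Fin n → ℝ}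
    (h : IsEigenbasis U v (fun j => Complex.exp (θ j * Complex.I))) (hθ : Antitone θ)
    (hm : ∀ j, θ j ∈ Set.Ioc (-Real.pi) Real.pi) : eigenAngle U = θ := by
  refine eq_of_antitone_of_map_eq (eigenAngle_antitone U) hθ ?_
  rw [map_eigenAngle, h.charpoly_roots, Multiset.map_map]
  refine Multiset.map_congr rfl fun j _ => ?_
  rw [Function.comp_apply, Complex.arg_exp_mul_I, toIocMod_eq_self]
  convert! hm j using 2
  ring

/-- Reduction to the Hermitian spectral theorem: H = arg U is Hermitian and U = e^{iH}, so an
eigenbasis of H serves for U. -/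
theorem exists_isEigenbasis_of_unitary {U : Matrix (Fin n) (Fin n) ℂ}
    (hU : U ∈ unitary (Matrix (Fin n) (Fin n) ℂ)) :
    ∃ v, IsEigenbasis U v (fun j => Complex.exp (eigenAngle U j * Complex.I)) := by
  have hN : IsStarNormal U := isStarNormal_of_mem_unitary hU
  have hc : ∀ (f : ℂ → ℂ) (s : Set ℂ), s.Finite → ContinuousOn f s := fun f s hs => hs.continuousOn f
  set H : Matrix (Fin n) (Fin n) ℂ := cfc (fun z => (z.arg : ℂ)) U with hH
  have hHs : H.IsHermitian := by
    show star H = H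
    rw [hH, ← cfc_star]
    simp
  have hsym := Matrix.isSymmetric_toEuclideanLin_iff.2 hHs
  have hn : Module.finrank ℂ (EuclideanSpace ℂ (Fin n)) = n := by simp
  set v := hsym.eigenvectorBasis hn
  set l := hsym.eigenvalues hn
  have hv : ∀ j, Matrix.toEuclideanLin H (v j) = (l j : ℂ) • v j := hsym.apply_eigenvectorBasis hn
  have hv0 : ∀ j, v j ≠ 0 := fun j => v.orthonormal.ne_zero j
  have hl : ∀ j, l j ∈ Set.Ioc (-Real.pi) Real.pi := by
    intro j
    have h1 := mem_spectrum_of_eigenvector (hv j) (hv0 j)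
    rw [hH, cfc_map_spectrum (fun z : ℂ => (z.arg : ℂ)) U hN (hc _ _ (Matrix.finite_spectrum U))] at h1
    obtain ⟨z, -, hz⟩ := h1
    rw [← Complex.ofReal_inj.1 hz]
    exact Complex.arg_mem_Ioc z
  have hUH : U = cfc (fun z => Complex.exp (z * Complex.I)) H := by
    rw [hH, ← cfc_comp' (fun z => Complex.exp (z * Complex.I)) _ U
      (hc _ _ ((Matrix.finite_spectrum U).image _)) (hc _ _ (Matrix.finite_spectrum U))]
    conv_lhs => rw [← cfc_id' ℂ U]
    refine cfc_congr fun z hz => ?_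
    have : ‖z‖ = 1 := by
      simpa using spectrum.norm_eq_one_of_unitary hU hz
    have h2 := Complex.norm_mul_exp_arg_mul_I z
    rw [this] at h2
    simpa using h2.symm
  have hvU : IsEigenbasis U v (fun j => Complex.exp (l j * Complex.I)) := by
    intro j
    rw [hUH]
    exact cfc_apply_eigenvector H hHs.isSelfAdjoint.isStarNormal _ (hv j)
  refine ⟨v, ?_⟩
  rw [hvU.eigenAngle_eq (hsym.eigenvalues_antitone hn) hl]
  exact hvU

/-! ### Doubly stochastic averages. -/

/-- By Birkhoff `p` is a convex combination of permutations; for each of them this is the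
rearrangement inequality. -/
theorem sum_mul_sum_le_of_mem_doublyStochastic {w α : Fin n → ℝ} (hw : Antitone w)
    (hα : Antitone α) {p : Matrix (Fin n) (Fin n) ℝ} (hp : p ∈ doublyStochastic ℝ (Fin n)) :
    ∑ j, w j * ∑ k, p j k * α k ≤ ∑ j, w j * α j := by
  obtain ⟨c, hc0, hc1, rfl⟩ := exists_eq_sum_perm_of_mem_doublyStochastic hp
  have h1 : ∀ σ : Equiv.Perm (Fin n), ∑ j, w j * α (σ j) ≤ ∑ j, w j * α j := fun σ =>
    (hw.monovary hα).sum_mul_comp_perm_le_sum_mul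
  calc ∑ j, w j * ∑ k, (∑ σ, c σ • Equiv.Perm.permMatrix ℝ σ) j k * α k
      = ∑ σ, c σ * ∑ j, w j * α (σ j) := by
        have h2 : ∀ j, ∑ k, (∑ σ, c σ • Equiv.Perm.permMatrix ℝ σ) j k * α k =
            ∑ σ, c σ * α (σ j) := by
          intro j
          simp only [Matrix.sum_apply, Matrix.smul_apply, smul_eq_mul, Finset.sum_mul]
          rw [Finset.sum_comm]
          refine Finset.sum_congr rfl fun σ _ => ?_
          rw [Finset.sum_eq_single (σ j)]
          · simp [Equiv.Perm.permMatrix, PEquiv.toMatrix_apply]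
          · intro b _ hb
            simp [Equiv.Perm.permMatrix, PEquiv.toMatrix_apply, Ne.symm hb]
          · simp
        simp only [h2, Finset.mul_sum]
        rw [Finset.sum_comm]
        exact Finset.sum_congr rfl fun σ _ => Finset.sum_congr rfl fun j _ => mul_left_comm _ _ _
    _ ≤ ∑ σ, c σ * ∑ j, w j * α j :=
        Finset.sum_le_sum fun σ _ => mul_le_mul_of_nonneg_left (h1 σ) (hc0 σ)
    _ = _ := by rw [← Finset.sum_mul, hc1, one_mul]

/-- The matrix of squared moduli of the inner products of two orthonormal bases. -/
def overlap (v w : OrthonormalBasis (Fin n) ℂ (EuclideanSpace ℂ (Fin n))) :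
    Matrix (Fin n) (Fin n) ℝ :=
  Matrix.of fun j k => ‖inner ℂ (w k) (v j)‖ ^ 2

theorem overlap_mem_doublyStochastic
    (v w : OrthonormalBasis (Fin n) ℂ (EuclideanSpace ℂ (Fin n))) :
    overlap v w ∈ doublyStochastic ℝ (Fin n) := by
  refine mem_doublyStochastic_iff_sum.2 ⟨fun j k => sq_nonneg _, fun j => ?_, fun k => ?_⟩
  · simp only [overlap, Matrix.of_apply]
    rw [w.sum_sq_norm_inner_right (v j), v.orthonormal.1 j, one_pow]
  · simp only [overlap, Matrix.of_apply]
    rw [v.sum_sq_norm_inner_left (w k), w.orthonormal.1 k, one_pow]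

theorem IsEigenbasis.inner_self_apply {A : Matrix (Fin n) (Fin n) ℂ}
    {w : OrthonormalBasis (Fin n) ℂ (EuclideanSpace ℂ (Fin n))} {c : Fin n → ℂ}
    (h : IsEigenbasis A w c) (x : EuclideanSpace ℂ (Fin n)) :
    inner ℂ x (Matrix.toEuclideanLin A x) = ∑ k, ((‖inner ℂ (w k) x‖ ^ 2 : ℝ) : ℂ) * c k := by
  have h1 : Matrix.toEuclideanLin A x = ∑ k, inner ℂ (w k) x • c k • w k := by
    conv_lhs => rw [← w.sum_repr' x]
    rw [map_sum]
    refine Finset.sum_congr rfl fun k _ => ?_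
    rw [map_smul, h k]
  rw [h1, inner_sum]
  refine Finset.sum_congr rfl fun k _ => ?_
  rw [inner_smul_right, inner_smul_right, ← inner_conj_symm x (w k), Complex.ofReal_pow,
    ← Complex.mul_conj']
  ring

/-! ### Mean angles to second order. -/

theorem abs_sub_sin_le_sq (x : ℝ) : |x - Real.sin x| ≤ x ^ 2 := by
  wlog hx : 0 ≤ x generalizing x
  · have := this (-x) (by linarith)
    rw [Real.sin_neg, neg_sq, ← abs_neg] at this
    convert! this using 2
    ring
  rw [abs_of_nonneg (by linarith [Real.sin_le hx])]
  rcases le_total x 1 with h1 | h1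
  · rcases eq_or_lt_of_le hx with rfl | h0
    · simp
    · nlinarith [Real.sin_gt_sub_cube h0, sq_nonneg x, mul_nonneg hx (sq_nonneg x)]
  · rcases le_total x 2 with h2 | h2
    · have : 0 ≤ Real.sin x := Real.sin_nonneg_of_nonneg_of_le_pi hx (by linarith [Real.pi_gt_three])
      nlinarith
    · nlinarith [Real.neg_one_le_sin x]

/-- As 2M < 2π, the function 1 - cos vanishes on [-2M, 2M] only at 0, and there to order two.
Concavity of sin on [0, π] makes this quantitative: sin y ≥ y sin M / M on [0, M], used at y =
|x|/2. -/
theorem exists_abs_sub_sin_le {M : ℝ} (h0 : 0 ≤ M) (hM : M < Real.pi) :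
    ∃ C : ℝ, 0 ≤ C ∧ ∀ x : ℝ, |x| ≤ 2 * M → |x - Real.sin x| ≤ C * (1 - Real.cos x) := by
  rcases eq_or_lt_of_le h0 with rfl | h0
  · refine ⟨0, le_rfl, fun x hx => ?_⟩
    have : x = 0 := by simpa using hx
    simp [this]
  have hs : 0 < Real.sin M := Real.sin_pos_of_pos_of_lt_pi h0 hM
  have key : ∀ y, 0 ≤ y → y ≤ M → y * Real.sin M ≤ M * Real.sin y := by
    intro y hy hyM
    have := strictConcaveOn_sin_Icc.concaveOn.2 (⟨le_rfl, Real.pi_pos.le⟩ : (0 : ℝ) ∈ Set.Icc 0 Real.pi)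
      (⟨h0.le, hM.le⟩ : M ∈ Set.Icc 0 Real.pi) (sub_nonneg.2 ((div_le_one h0).2 hyM))
      (div_nonneg hy h0.le) (by ring)
    simp only [Real.sin_zero, smul_eq_mul, mul_zero, zero_add] at this
    rw [div_mul_cancel₀ _ h0.ne', div_mul_eq_mul_div, div_le_iff₀ h0] at this
    linarith
  refine ⟨2 * M ^ 2 / Real.sin M ^ 2, by positivity, fun x hx => (abs_sub_sin_le_sq x).trans ?_⟩
  have h1 := key (|x| / 2) (by positivity) (by linarith)
  have h2 : (|x| / 2 * Real.sin M) ^ 2 ≤ (M * Real.sin (|x| / 2)) ^ 2 :=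
    pow_le_pow_left₀ (by positivity) h1 2
  have h3 : 1 - Real.cos x = 2 * Real.sin (|x| / 2) ^ 2 := by
    rw [← Real.cos_abs x, Real.sin_sq_eq_half_sub, mul_div_cancel₀ _ (by norm_num : (2:ℝ) ≠ 0)]
    ring
  rw [h3, div_mul_eq_mul_div, le_div_iff₀ (by positivity), ← sq_abs x]
  linarith

/-- If two probability measures on the circle have the same mean and one of them is concentrated
near `1`, then their mean angles agree to second order. -/
theorem abs_sum_add_sum_le {ι κ : Type*} [Fintype ι] [Fintype κ] {p x : ι → ℝ} {r y : κ → ℝ}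
    {C : ℝ} (hC : 0 ≤ C)
    (hp : ∀ k, 0 ≤ p k) (hr : ∀ k, 0 ≤ r k) (hp1 : ∑ k, p k = 1) (hr1 : ∑ k, r k = 1)
    (hx : ∀ k, |x k - Real.sin (x k)| ≤ C * (1 - Real.cos (x k)))
    (h : ∑ k, (p k : ℂ) * Complex.exp (x k * Complex.I) =
      ∑ k, (r k : ℂ) * Complex.exp (-(y k * Complex.I))) :
    |∑ k, p k * x k + ∑ k, r k * y k| ≤ (C + 1) * ∑ k, r k * y k ^ 2 := by
  have hre : ∑ k, p k * Real.cos (x k) = ∑ k, r k * Real.cos (y k) := by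
    have := congrArg Complex.re h
    simpa [Complex.re_sum, Complex.re_ofReal_mul, Complex.exp_re, ← neg_mul] using this
  have him : ∑ k, p k * Real.sin (x k) = -∑ k, r k * Real.sin (y k) := by
    have := congrArg Complex.im h
    simpa [Complex.im_sum, Complex.im_ofReal_mul, Complex.exp_im, ← neg_mul, ← Finset.sum_neg_distrib] using this
  have e1 : ∑ k, p k * x k + ∑ k, r k * y k =
      ∑ k, p k * (x k - Real.sin (x k)) + ∑ k, r k * (y k - Real.sin (y k)) := by
    simp only [mul_sub, Finset.sum_sub_distrib, him]
    ring
  -- Equality of the real parts of the means transfers the defect 1 - cos from `x` to the small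
  -- angles `y`.
  have e2 : |∑ k, p k * (x k - Real.sin (x k))| ≤ C * ∑ k, r k * y k ^ 2 := by
    calc |∑ k, p k * (x k - Real.sin (x k))|
        ≤ ∑ k, p k * (C * (1 - Real.cos (x k))) := by
          refine (Finset.abs_sum_le_sum_abs _ _).trans (Finset.sum_le_sum fun k _ => ?_)
          rw [abs_mul, abs_of_nonneg (hp k)]
          exact mul_le_mul_of_nonneg_left (hx k) (hp k)
      _ = C * ∑ k, r k * (1 - Real.cos (y k)) := by
          simp only [mul_sub, mul_one, Finset.sum_sub_distrib, hr1, ← hre, mul_left_comm _ C,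
            ← Finset.mul_sum, hp1, ← Finset.sum_mul, one_mul]
      _ ≤ _ := by
          refine mul_le_mul_of_nonneg_left (Finset.sum_le_sum fun k _ => ?_) hC
          exact mul_le_mul_of_nonneg_left
            (by nlinarith [Real.one_sub_sq_div_two_le_cos (x := y k)]) (hr k)
  have e3 : |∑ k, r k * (y k - Real.sin (y k))| ≤ ∑ k, r k * y k ^ 2 := by
    refine (Finset.abs_sum_le_sum_abs _ _).trans (Finset.sum_le_sum fun k _ => ?_)
    rw [abs_mul, abs_of_nonneg (hr k)]
    exact mul_le_mul_of_nonneg_left (abs_sub_sin_le_sq _) (hr k)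
  rw [e1]
  refine (abs_add_le _ _).trans ?_
  linarith

/-! ### Multiplication by one small factor. -/

theorem toEuclideanLin_star_apply {R : Matrix (Fin n) (Fin n) ℂ}
    (hR : R ∈ unitary (Matrix (Fin n) (Fin n) ℂ)) {a : ℝ} {x : EuclideanSpace ℂ (Fin n)}
    (h : Matrix.toEuclideanLin R x = Complex.exp (a * Complex.I) • x) :
    Matrix.toEuclideanLin (star R) x = Complex.exp (-(a * Complex.I)) • x := by
  have h1 := congrArg (Matrix.toEuclideanLin (star R)) h
  rw [← toEuclideanLin_mul_apply, Unitary.star_mul_self_of_mem hR, toEuclideanLin_one_apply,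
    map_smul] at h1
  conv_rhs => rw [h1]
  rw [smul_smul, ← Complex.exp_add, neg_add_cancel, Complex.exp_zero, one_smul]

theorem sum_mul_angle_le_of_step {R W : Matrix (Fin n) (Fin n) ℂ}
    (hR : R ∈ unitary (Matrix (Fin n) (Fin n) ℂ))
    {v w q : OrthonormalBasis (Fin n) ℂ (EuclideanSpace ℂ (Fin n))} {θ φ β : Fin n → ℝ}
    (hv : IsEigenbasis (R * W) v fun j => Complex.exp (θ j * Complex.I))
    (hw : IsEigenbasis W w fun j => Complex.exp (φ j * Complex.I))
    (hq : IsEigenbasis R q fun j => Complex.exp (β j * Complex.I))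
    (hφ : Antitone φ) (hβ : Antitone β) {C M b : ℝ} (hC : 0 ≤ C)
    (hx : ∀ x : ℝ, |x| ≤ 2 * M → |x - Real.sin x| ≤ C * (1 - Real.cos x))
    (hθM : ∀ j, |θ j| ≤ M) (hφM : ∀ j, |φ j| ≤ M) (hb : ∀ j, β j ^ 2 ≤ b)
    {u : Fin n → ℝ} (hu : Antitone u) :
    ∑ j, u j * θ j ≤ ∑ j, u j * φ j + ∑ j, u j * β j + (∑ j, |u j|) * ((C + 1) * b) := by
  have hp := mem_doublyStochastic_iff_sum.1 (overlap_mem_doublyStochastic v w)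
  have hr := mem_doublyStochastic_iff_sum.1 (overlap_mem_doublyStochastic v q)
  have hq' : IsEigenbasis (star R) q fun j => Complex.exp (-(β j * Complex.I)) :=
    fun j => toEuclideanLin_star_apply hR (hq j)
  -- W v_j = e^{iθ_j} R* v_j, paired with v_j, says that the angles φ_k - θ_j and -β_k have the same
  -- mean on the circle under the two rows of overlaps.
  have key : ∀ j, |∑ k, overlap v w j k * (φ k - θ j) + ∑ k, overlap v q j k * β k| ≤
      (C + 1) * b := by
    intro j
    have h1 : Matrix.toEuclideanLin W (v j) =
        Complex.exp (θ j * Complex.I) • Matrix.toEuclideanLin (star R) (v j) := by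
      rw [← map_smul, ← hv j, ← toEuclideanLin_mul_apply, ← mul_assoc,
        Unitary.star_mul_self_of_mem hR, one_mul]
    have h2 := congrArg (inner ℂ (v j)) h1
    rw [inner_smul_right, hw.inner_self_apply, hq'.inner_self_apply] at h2
    refine (abs_sum_add_sum_le hC (hp.1 j) (hr.1 j) (hp.2.1 j) (hr.2.1 j)
      (fun k => hx _ ((abs_sub _ _).trans (by linarith [hθM j, hφM k]))) ?_).trans ?_
    · have h3 : ∑ k, ((overlap v w j k : ℝ) : ℂ) * Complex.exp (((φ k - θ j : ℝ) : ℂ) * Complex.I) =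
          Complex.exp (-(θ j * Complex.I)) *
          ∑ k, ((‖inner ℂ (w k) (v j)‖ ^ 2 : ℝ) : ℂ) * Complex.exp (φ k * Complex.I) := by
        rw [Finset.mul_sum]
        refine Finset.sum_congr rfl fun k _ => ?_
        rw [mul_left_comm, ← Complex.exp_add]
        simp only [overlap, Matrix.of_apply, Complex.ofReal_sub]
        ring_nf
      rw [h3, h2, ← mul_assoc, ← Complex.exp_add, neg_add_cancel, Complex.exp_zero, one_mul]
      rfl
    · refine mul_le_mul_of_nonneg_left ?_ (by linarith)
      calc ∑ k, overlap v q j k * β k ^ 2 ≤ ∑ k, overlap v q j k * b :=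
            Finset.sum_le_sum fun k _ => mul_le_mul_of_nonneg_left (hb k) (hr.1 j k)
        _ = b := by rw [← Finset.sum_mul, hr.2.1 j, one_mul]
  have h4 : ∀ j, u j * θ j ≤ u j * ∑ k, overlap v w j k * φ k +
      u j * ∑ k, overlap v q j k * β k + |u j| * ((C + 1) * b) := by
    intro j
    have e : ∑ k, overlap v w j k * (φ k - θ j) = ∑ k, overlap v w j k * φ k - θ j := by
      simp only [mul_sub, Finset.sum_sub_distrib, ← Finset.sum_mul, hp.2.1 j, one_mul]
    have h5 := mul_le_mul_of_nonneg_left (key j) (abs_nonneg (u j))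
    rw [← abs_mul, e] at h5
    linarith [neg_abs_le (u j * (∑ k, overlap v w j k * φ k - θ j + ∑ k, overlap v q j k * β k))]
  calc ∑ j, u j * θ j ≤ ∑ j, (u j * ∑ k, overlap v w j k * φ k +
      u j * ∑ k, overlap v q j k * β k + |u j| * ((C + 1) * b)) := Finset.sum_le_sum fun j _ => h4 j
    _ = ∑ j, u j * ∑ k, overlap v w j k * φ k + ∑ j, u j * ∑ k, overlap v q j k * β k +
        (∑ j, |u j|) * ((C + 1) * b) := by
      rw [Finset.sum_add_distrib, Finset.sum_add_distrib, Finset.sum_mul]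
    _ ≤ _ := by
      gcongr ?_ + ?_ + _
      · exact sum_mul_sum_le_of_mem_doublyStochastic hu hφ (overlap_mem_doublyStochastic v w)
      · exact sum_mul_sum_le_of_mem_doublyStochastic hu hβ (overlap_mem_doublyStochastic v q)

/-! ### Subadditivity of weighted angle sums. -/

theorem IsEigenbasis.ext {A B : Matrix (Fin n) (Fin n) ℂ}
    {v : OrthonormalBasis (Fin n) ℂ (EuclideanSpace ℂ (Fin n))} {c : Fin n → ℂ}
    (hA : IsEigenbasis A v c) (hB : IsEigenbasis B v c) : A = B := by
  apply Matrix.toEuclideanLin.injective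
  refine v.toBasis.ext fun j => ?_
  simp only [OrthonormalBasis.coe_toBasis]
  rw [hA j, hB j]

theorem IsEigenbasis.mul {A B : Matrix (Fin n) (Fin n) ℂ}
    {v : OrthonormalBasis (Fin n) ℂ (EuclideanSpace ℂ (Fin n))} {c d : Fin n → ℂ}
    (hA : IsEigenbasis A v c) (hB : IsEigenbasis B v d) :
    IsEigenbasis (A * B) v fun j => c j * d j := by
  intro j
  rw [toEuclideanLin_mul_apply, hB j, map_smul, hA j, smul_smul, mul_comm]

theorem IsEigenbasis.pow {A : Matrix (Fin n) (Fin n) ℂ}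
    {v : OrthonormalBasis (Fin n) ℂ (EuclideanSpace ℂ (Fin n))} {c : Fin n → ℂ}
    (hA : IsEigenbasis A v c) (k : ℕ) : IsEigenbasis (A ^ k) v fun j => c j ^ k := by
  induction k with
  | zero => intro j; simp
  | succ k ih => simpa only [pow_succ] using ih.mul hA

/-- The numerical range is made of convex combinations of the eigenvalues. -/
theorem IsEigenbasis.cos_le_re_inner {A : Matrix (Fin n) (Fin n) ℂ}
    {v : OrthonormalBasis (Fin n) ℂ (EuclideanSpace ℂ (Fin n))} {β : Fin n → ℝ}
    (hA : IsEigenbasis A v fun j => Complex.exp (β j * Complex.I)) {a : ℝ}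
    (ha : a ≤ Real.pi) (hβ : ∀ j, |β j| ≤ a) {x : EuclideanSpace ℂ (Fin n)} (hx : ‖x‖ = 1) :
    Real.cos a ≤ (inner ℂ x (Matrix.toEuclideanLin A x)).re := by
  rw [hA.inner_self_apply, Complex.re_sum]
  have h1 : ∑ k, ‖inner ℂ (v k) x‖ ^ 2 = 1 := by rw [v.sum_sq_norm_inner_right, hx, one_pow]
  calc Real.cos a = ∑ k, ‖inner ℂ (v k) x‖ ^ 2 * Real.cos a := by
        rw [← Finset.sum_mul, h1, one_mul]
    _ ≤ _ := by
      refine Finset.sum_le_sum fun k _ => ?_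
      rw [Complex.re_ofReal_mul, Complex.exp_ofReal_mul_I_re]
      refine mul_le_mul_of_nonneg_left ?_ (sq_nonneg _)
      rw [← Real.cos_abs (β k)]
      exact Real.cos_le_cos_of_nonneg_of_le_pi (abs_nonneg _) ha (hβ k)

/-- With z = ⟨Rx, x⟩ one has |z| ≤ 1, and both z and e^{iφ}z have real part at least cos a. Adding
them, 2 cos a ≤ |1 + e^{iφ}| = 2|cos(φ/2)|. -/
theorem abs_angle_mul_le {R V : Matrix (Fin n) (Fin n) ℂ}
    (hR : R ∈ unitary (Matrix (Fin n) (Fin n) ℂ)) {a φ : ℝ} (ha0 : 0 ≤ a) (ha : a < Real.pi / 2)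
    {x : EuclideanSpace ℂ (Fin n)} (hx : ‖x‖ = 1)
    (h1 : Real.cos a ≤ (inner ℂ x (Matrix.toEuclideanLin R x)).re)
    (h2 : Real.cos a ≤ (inner ℂ x (Matrix.toEuclideanLin V x)).re)
    (h : Matrix.toEuclideanLin (R * V) x = Complex.exp (φ * Complex.I) • x) (hφ : |φ| ≤ Real.pi) :
    |φ| ≤ 2 * a := by
  set z := inner ℂ (Matrix.toEuclideanLin R x) x with hz
  have hadj : ∀ y, inner ℂ x (Matrix.toEuclideanLin (star R) y) =
      inner ℂ (Matrix.toEuclideanLin R x) y := by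
    intro y
    rw [Matrix.star_eq_conjTranspose, Matrix.toEuclideanLin_conjTranspose_eq_adjoint,
      LinearMap.adjoint_inner_right]
  have hV : Matrix.toEuclideanLin V x =
      Complex.exp (φ * Complex.I) • Matrix.toEuclideanLin (star R) x := by
    rw [← map_smul, ← h, ← toEuclideanLin_mul_apply, ← mul_assoc,
      Unitary.star_mul_self_of_mem hR, one_mul]
  have h3 : Real.cos a ≤ z.re := by
    rwa [hz, ← inner_conj_symm, Complex.conj_re]
  have h4 : Real.cos a ≤ (Complex.exp (φ * Complex.I) * z).re := by
    rwa [hV, inner_smul_right, hadj] at h2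
  have hRx : ‖Matrix.toEuclideanLin R x‖ = 1 := by
    have e : inner ℂ (Matrix.toEuclideanLin R x) (Matrix.toEuclideanLin R x) = inner ℂ x x := by
      rw [← hadj, ← toEuclideanLin_mul_apply, Unitary.star_mul_self_of_mem hR,
        toEuclideanLin_one_apply]
    rw [inner_self_eq_norm_sq_to_K, inner_self_eq_norm_sq_to_K, hx] at e
    have e' : ‖Matrix.toEuclideanLin R x‖ ^ 2 = 1 := by
      have := congrArg Complex.re e
      simpa [← Complex.ofReal_pow] using this
    exact (pow_eq_one_iff_of_nonneg (norm_nonneg _) two_ne_zero).1 e'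
  have hz1 : ‖z‖ ≤ 1 := by
    have := norm_inner_le_norm (𝕜 := ℂ) (Matrix.toEuclideanLin R x) x
    rwa [hRx, hx, one_mul] at this
  have hc : 0 < Real.cos a := Real.cos_pos_of_mem_Ioo ⟨by linarith, ha⟩
  have h5 : (1 + Complex.exp (φ * Complex.I)) * z = z + Complex.exp (φ * Complex.I) * z := by ring
  have h6 : 2 * Real.cos a ≤ ‖1 + Complex.exp (φ * Complex.I)‖ := by
    calc 2 * Real.cos a ≤ ((1 + Complex.exp (φ * Complex.I)) * z).re := by
          rw [h5, Complex.add_re]; linarith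
      _ ≤ ‖(1 + Complex.exp (φ * Complex.I)) * z‖ := Complex.re_le_norm _
      _ ≤ _ := by
        rw [norm_mul]
        exact mul_le_of_le_one_right (norm_nonneg _) hz1
  have h7 : ‖1 + Complex.exp (φ * Complex.I)‖ ^ 2 = 2 + 2 * Real.cos φ := by
    rw [← Complex.normSq_eq_norm_sq, Complex.normSq_apply]
    simp only [Complex.add_re, Complex.one_re, Complex.exp_ofReal_mul_I_re, Complex.add_im,
      Complex.one_im, Complex.exp_ofReal_mul_I_im]
    nlinarith [Real.sin_sq_add_cos_sq φ]
  have h8 : Real.cos (2 * a) ≤ Real.cos |φ| := by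
    rw [Real.cos_two_mul, Real.cos_abs]
    nlinarith
  by_contra! hlt
  exact absurd (Real.cos_lt_cos_of_nonneg_of_le_pi (by linarith) hφ hlt) (not_lt.2 h8)

theorem exists_unitary_root {U : Matrix (Fin n) (Fin n) ℂ}
    (hU : U ∈ unitary (Matrix (Fin n) (Fin n) ℂ)) (h : ℝ) :
    ∃ R ∈ unitary (Matrix (Fin n) (Fin n) ℂ), ∀ v,
      IsEigenbasis U v (fun j => Complex.exp (eigenAngle U j * Complex.I)) →
      IsEigenbasis R v (fun j => Complex.exp ((h * eigenAngle U j : ℝ) * Complex.I)) := by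
  have hN : IsStarNormal U := isStarNormal_of_mem_unitary hU
  refine ⟨cfc (fun z => Complex.exp ((h * z.arg : ℝ) * Complex.I)) U, ?_, fun v hv j => ?_⟩
  · rw [cfc_unitary_iff _ U hN ((Matrix.finite_spectrum U).continuousOn _)]
    intro z _
    rw [Complex.star_def, mul_comm, Complex.mul_conj', Complex.norm_exp_ofReal_mul_I]
    simp
  · rw [cfc_apply_eigenvector U hN _ (hv j), Complex.arg_exp_mul_I, toIocMod_eq_self _ |>.2]
    convert! eigenAngle_mem U j using 2
    ring

theorem sum_mul_eigenAngle_mul_le {U V : Matrix (Fin n) (Fin n) ℂ}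
    (hU : U ∈ unitary (Matrix (Fin n) (Fin n) ℂ)) (hV : V ∈ unitary (Matrix (Fin n) (Fin n) ℂ))
    (hUa : ∀ j, |eigenAngle U j| < Real.pi / 2) (hVa : ∀ j, |eigenAngle V j| < Real.pi / 2)
    {u : Fin n → ℝ} (hu : Antitone u) :
    ∑ j, u j * eigenAngle (U * V) j ≤
      ∑ j, u j * eigenAngle U j + ∑ j, u j * eigenAngle V j := by
  -- Finitely many angles have a common bound strictly below π/2, so all partial products have
  -- angles at most 2a < π.
  obtain ⟨a, ha0, haU, haV, ha⟩ : ∃ a, 0 ≤ a ∧ (∀ j, |eigenAngle U j| ≤ a) ∧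
      (∀ j, |eigenAngle V j| ≤ a) ∧ a < Real.pi / 2 := by
    have e1 : ∀ b < Real.pi / 2, ∀ᶠ a in nhdsWithin (Real.pi / 2) (Set.Iio (Real.pi / 2)), b ≤ a :=
      fun b hb => (Filter.eventually_of_mem (Ioo_mem_nhdsLT hb) fun a h => h.1.le)
    exact ((e1 0 (by positivity)).and ((Filter.eventually_all.2 fun j => e1 _ (hUa j)).and
      ((Filter.eventually_all.2 fun j => e1 _ (hVa j)).and
        (Filter.eventually_of_mem self_mem_nhdsWithin fun a h => h)))).exists
  obtain ⟨q, hq⟩ := exists_isEigenbasis_of_unitary hU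
  obtain ⟨p, hp⟩ := exists_isEigenbasis_of_unitary hV
  obtain ⟨C, hC0, hC⟩ := exists_abs_sub_sin_le (M := 2 * a) (by linarith) (by linarith)
  set K := (∑ j, |u j|) * ((C + 1) * a ^ 2) with hK
  have main : ∀ N : ℕ, ∑ j, u j * eigenAngle (U * V) j ≤
      ∑ j, u j * eigenAngle U j + ∑ j, u j * eigenAngle V j + K * (1 / ((N : ℝ) + 1)) := by
    intro N
    set h : ℝ := 1 / ((N : ℝ) + 1) with hh
    have h0 : 0 < h := by positivity
    have hN : ((N + 1 : ℕ) : ℝ) * h = 1 := by rw [hh]; push_cast; field_simp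
    obtain ⟨R, hR, hRq⟩ := exists_unitary_root hU h
    specialize hRq q hq
    have hRk : ∀ k : ℕ, IsEigenbasis (R ^ k) q
        fun j => Complex.exp ((k * (h * eigenAngle U j) : ℝ) * Complex.I) := by
      intro k
      convert! hRq.pow k using 2 with j
      rw [← Complex.exp_nat_mul]
      push_cast
      ring_nf
    have hRN : R ^ (N + 1) = U := by
      refine (hRk (N + 1)).ext ?_
      simpa only [← mul_assoc, hN, one_mul] using hq
    have hW : ∀ k : ℕ, R ^ k * V ∈ unitary (Matrix (Fin n) (Fin n) ℂ) := fun k =>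
      mul_mem (pow_mem hR k) hV
    have hbound : ∀ k : ℕ, k ≤ N + 1 → ∀ j, |eigenAngle (R ^ k * V) j| ≤ 2 * a := by
      intro k hk j
      obtain ⟨v, hv⟩ := exists_isEigenbasis_of_unitary (hW k)
      have hvj := v.orthonormal.1 j
      refine abs_angle_mul_le (pow_mem hR k) ha0 ha hvj
        ((hRk k).cos_le_re_inner (by linarith) (fun i => ?_) hvj)
        (hp.cos_le_re_inner (by linarith) haV hvj) (hv j)
        (abs_le.2 ⟨(eigenAngle_mem _ j).1.le, (eigenAngle_mem _ j).2⟩)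
      rw [← mul_assoc, abs_mul, abs_of_nonneg (by positivity)]
      have : (k : ℝ) * h ≤ 1 := by
        rw [← hN]
        exact mul_le_mul_of_nonneg_right (by exact_mod_cast hk) h0.le
      calc (k : ℝ) * h * |eigenAngle U i| ≤ 1 * |eigenAngle U i| :=
            mul_le_mul_of_nonneg_right this (abs_nonneg _)
        _ ≤ a := by rw [one_mul]; exact haU i
    -- Each factor contributes an error K h²; after N + 1 = 1/h factors the total is K h.
    have ind : ∀ k : ℕ, k ≤ N + 1 → ∑ j, u j * eigenAngle (R ^ k * V) j ≤
        (k * h) * ∑ j, u j * eigenAngle U j + ∑ j, u j * eigenAngle V j + (k * h) * (K * h) := by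
      intro k
      induction k with
      | zero => intro _; simp
      | succ k ih =>
        intro hk
        obtain ⟨v, hv⟩ := exists_isEigenbasis_of_unitary (hW (k + 1))
        obtain ⟨w, hw⟩ := exists_isEigenbasis_of_unitary (hW k)
        have hb1 := hbound (k + 1) hk
        rw [pow_succ', mul_assoc] at hv hb1 ⊢
        have step := sum_mul_angle_le_of_step hR hv hw hRq (eigenAngle_antitone _)
          ((eigenAngle_antitone U).const_mul h0.le) hC0 hC hb1 (hbound k (by omega))
          (b := h ^ 2 * a ^ 2) (fun j => by
            rw [mul_pow]
            exact mul_le_mul_of_nonneg_left (sq_le_sq.2 (by rw [abs_of_nonneg ha0]; exact haU j))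
              (sq_nonneg h)) hu
        have e : ∑ j, u j * (h * eigenAngle U j) = h * ∑ j, u j * eigenAngle U j := by
          rw [Finset.mul_sum]
          exact Finset.sum_congr rfl fun j _ => mul_left_comm _ _ _
        have e2 : (∑ j, |u j|) * ((C + 1) * (h ^ 2 * a ^ 2)) = h * (K * h) := by rw [hK]; ring
        rw [e, e2] at step
        have := ih (by omega)
        push_cast
        linarith
    have := ind (N + 1) le_rfl
    rwa [hRN, hN, one_mul, one_mul] at this
  have lim : Filter.Tendsto (fun N : ℕ => ∑ j, u j * eigenAngle U j + ∑ j, u j * eigenAngle V j +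
      K * (1 / ((N : ℝ) + 1))) Filter.atTop
      (nhds (∑ j, u j * eigenAngle U j + ∑ j, u j * eigenAngle V j + K * 0)) :=
    (tendsto_one_div_add_atTop_nhds_zero_nat.const_mul K).const_add _
  rw [mul_zero, add_zero] at lim
  exact ge_of_tendsto' lim main

/-! ### Distance to the identity and angles. -/

theorem IsEigenbasis.norm_sub_one_le {U : Matrix (Fin n) (Fin n) ℂ}
    {v : OrthonormalBasis (Fin n) ℂ (EuclideanSpace ℂ (Fin n))} {c : Fin n → ℂ}
    (h : IsEigenbasis U v c) (j : Fin n) : ‖c j - 1‖ ≤ ‖U - 1‖ := by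
  have h1 : Matrix.toEuclideanCLM (𝕜 := ℂ) (U - 1) (v j) = (c j - 1) • v j := by
    change Matrix.toEuclideanLin (U - 1) (v j) = _
    rw [map_sub, LinearMap.sub_apply, h j, toEuclideanLin_one_apply, sub_smul, one_smul]
  have h2 := (Matrix.toEuclideanCLM (𝕜 := ℂ) (U - 1)).le_opNorm (v j)
  rwa [h1, norm_smul, v.orthonormal.1 j, mul_one, mul_one] at h2

theorem abs_lt_pi_div_two {θ : ℝ} (hθ : |θ| ≤ Real.pi)
    (h : ‖Complex.exp (θ * Complex.I) - 1‖ < √2) : |θ| < Real.pi / 2 := by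
  rw [mul_comm, Complex.norm_exp_I_mul_ofReal_sub_one] at h
  by_contra! hlt
  have h1 : Real.cos θ ≤ 0 := by
    rw [← Real.cos_abs]
    exact Real.cos_nonpos_of_pi_div_two_le_of_le hlt (by linarith [Real.pi_pos])
  have h2 : ‖2 * Real.sin (θ / 2)‖ ^ 2 < 2 := by
    have := pow_lt_pow_left₀ h (norm_nonneg _) two_ne_zero
    rwa [Real.sq_sqrt (by norm_num)] at this
  rw [Real.norm_eq_abs, sq_abs, mul_pow, Real.sin_sq_eq_half_sub, mul_div_cancel₀ _ two_ne_zero] at h2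
  linarith

/-- Jordan's inequality for |e^{iθ} - 1| = 2|sin(θ/2)|. -/
theorem abs_le_mul_norm_exp_sub_one {θ : ℝ} (hθ : |θ| ≤ Real.pi) :
    |θ| ≤ Real.pi / 2 * ‖Complex.exp (θ * Complex.I) - 1‖ := by
  rw [mul_comm (θ : ℂ), Complex.norm_exp_I_mul_ofReal_sub_one, Real.norm_eq_abs, abs_mul, abs_two]
  have h1 := Real.mul_abs_le_abs_sin (x := θ / 2)
    (by rw [abs_div, abs_two]; linarith)
  rw [abs_div, abs_two] at h1
  have h2 := mul_le_mul_of_nonneg_left h1 Real.pi_pos.le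
  have h3 : Real.pi * (2 / Real.pi * (|θ| / 2)) = |θ| := by field_simp
  linarith

theorem abs_eigenAngle_le_pi (U : Matrix (Fin n) (Fin n) ℂ) (j : Fin n) :
    |eigenAngle U j| ≤ Real.pi :=
  abs_le.2 ⟨(eigenAngle_mem U j).1.le, (eigenAngle_mem U j).2⟩

theorem abs_eigenAngle_lt {U : Matrix (Fin n) (Fin n) ℂ}
    (hU : U ∈ unitary (Matrix (Fin n) (Fin n) ℂ)) (h : ‖U - 1‖ < √2) (j : Fin n) :
    |eigenAngle U j| < Real.pi / 2 := by
  obtain ⟨v, hv⟩ := exists_isEigenbasis_of_unitary hU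
  exact abs_lt_pi_div_two (abs_eigenAngle_le_pi U j) ((hv.norm_sub_one_le j).trans_lt h)

theorem abs_eigenAngle_le {U : Matrix (Fin n) (Fin n) ℂ}
    (hU : U ∈ unitary (Matrix (Fin n) (Fin n) ℂ)) (j : Fin n) :
    |eigenAngle U j| ≤ Real.pi / 2 * ‖U - 1‖ := by
  obtain ⟨v, hv⟩ := exists_isEigenbasis_of_unitary hU
  exact (abs_le_mul_norm_exp_sub_one (abs_eigenAngle_le_pi U j)).trans
    (mul_le_mul_of_nonneg_left (hv.norm_sub_one_le j) (by positivity))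

theorem eigenAngle_mul_self {U : Matrix (Fin n) (Fin n) ℂ}
    (hU : U ∈ unitary (Matrix (Fin n) (Fin n) ℂ)) (h : ∀ j, |eigenAngle U j| < Real.pi / 2) :
    eigenAngle (U * U) = fun j => 2 * eigenAngle U j := by
  obtain ⟨v, hv⟩ := exists_isEigenbasis_of_unitary hU
  refine IsEigenbasis.eigenAngle_eq (v := v) ?_
    ((eigenAngle_antitone U).const_mul (by norm_num)) fun j => ?_
  · convert! hv.mul hv using 2 with j
    rw [← Complex.exp_add]
    push_cast
    ring_nf
  · have := abs_lt.1 (h j)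
    exact ⟨by linarith, by linarith⟩

/-! ### Convexity along the segment. -/

/-- Subtract the chord: if the difference had a positive maximum, the midpoint inequality would fail
at the leftmost point where it is attained. -/
theorem convexOn_Icc_of_midpoint {f : ℝ → ℝ} {a b : ℝ} (hc : ContinuousOn f (Set.Icc a b))
    (h : ∀ t s, t - s ∈ Set.Icc a b → t + s ∈ Set.Icc a b → 2 * f t ≤ f (t - s) + f (t + s)) :
    ConvexOn ℝ (Set.Icc a b) f := by
  refine LinearOrder.convexOn_of_lt (convex_Icc a b) fun x hx y hy hxy p q hp hq hpq => ?_
  simp only [smul_eq_mul]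
  have hsub : Set.Icc x y ⊆ Set.Icc a b := Set.Icc_subset_Icc hx.1 hy.2
  set g : ℝ → ℝ := fun z => f z - (f x + (f y - f x) / (y - x) * (z - x)) with hg
  have hgc : ContinuousOn g (Set.Icc x y) := (hc.mono hsub).sub (by fun_prop)
  have hgx : g x = 0 := by simp [hg]
  have hyx : y - x ≠ 0 := by linarith
  have hgy : g y = 0 := by simp only [hg]; field_simp; ring
  have hgmid : ∀ t s, t - s ∈ Set.Icc x y → t + s ∈ Set.Icc x y →
      2 * g t ≤ g (t - s) + g (t + s) := by
    intro t s h1 h2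
    have := h t s (hsub h1) (hsub h2)
    simp only [hg]
    linarith
  have hle : ∀ z ∈ Set.Icc x y, g z ≤ 0 := by
    by_contra! hne
    obtain ⟨z, hz, hzpos⟩ := hne
    obtain ⟨m, hm, hmax⟩ := isCompact_Icc.exists_isMaxOn ⟨z, hz⟩ hgc
    have hmpos : 0 < g m := hzpos.trans_le (hmax hz)
    have hZ : IsCompact (Set.Icc x y ∩ g ⁻¹' {g m}) :=
      isCompact_Icc.of_isClosed_subset
        (hgc.preimage_isClosed_of_isClosed isClosed_Icc isClosed_singleton) Set.inter_subset_left
    obtain ⟨c, ⟨hcI, hcm⟩, hcl⟩ := hZ.exists_isLeast ⟨m, hm, rfl⟩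
    have hcm : g c = g m := hcm
    have hcx : x < c := lt_of_le_of_ne hcI.1 (by rintro rfl; linarith)
    have hcy : c < y := lt_of_le_of_ne hcI.2 (by rintro rfl; linarith)
    set d := min (c - x) (y - c)
    have hd : 0 < d := lt_min (by linarith) (by linarith)
    have hd1 : d ≤ c - x := min_le_left _ _
    have hd2 : d ≤ y - c := min_le_right _ _
    have h1 : c - d ∈ Set.Icc x y := ⟨by linarith, by linarith⟩
    have h2 : c + d ∈ Set.Icc x y := ⟨by linarith, by linarith⟩
    have h3 : g (c - d) ≠ g m := fun he => by linarith [hcl ⟨h1, he⟩]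
    have h4 : g (c - d) < g m := lt_of_le_of_ne (hmax h1) h3
    have h5 : g (c + d) ≤ g m := hmax h2
    linarith [hgmid c d h1 h2]
  have hz : p * x + q * y ∈ Set.Icc x y :=
    convex_Icc x y (Set.left_mem_Icc.2 hxy.le) (Set.right_mem_Icc.2 hxy.le) hp.le hq.le hpq
  have := hle _ hz
  have e : (f y - f x) / (y - x) * (p * x + q * y - x) = q * (f y - f x) := by
    have : p * x + q * y - x = q * (y - x) := by rw [show p = 1 - q by linarith]; ring
    rw [this]; field_simp
  simp only [hg, e] at this
  rw [show p = 1 - q by linarith] at this ⊢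
  linarith

theorem exp_smul_mem_unitary {x : Matrix (Fin n) (Fin n) ℂ} (hx : x.IsHermitian) (t : ℝ) :
    NormedSpace.exp ((Complex.I * (t : ℂ)) • x) ∈ unitary (Matrix (Fin n) (Fin n) ℂ) := by
  have h1 : IsSelfAdjoint ((t : ℂ) • x) := by
    rw [IsSelfAdjoint, star_smul, Complex.star_def, Complex.conj_ofReal, Matrix.star_eq_conjTranspose,
      hx.eq]
  have := (selfAdjoint.expUnitary ⟨(t : ℂ) • x, h1⟩).2
  rwa [selfAdjoint.expUnitary_coe, smul_smul] at this

theorem segment_mem_unitary {x y : Matrix (Fin n) (Fin n) ℂ} (hx : x.IsHermitian)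
    (hy : y.IsHermitian) (t : ℝ) : segment x y t ∈ unitary (Matrix (Fin n) (Fin n) ℂ) :=
  mul_mem (exp_smul_mem_unitary hx t) (by simpa using exp_smul_mem_unitary hy 1)

theorem exp_mul_segment (x y : Matrix (Fin n) (Fin n) ℂ) (s t : ℝ) :
    NormedSpace.exp ((Complex.I * (s : ℂ)) • x) * segment x y t = segment x y (s + t) := by
  rw [segment, segment, ← mul_assoc, ← Matrix.exp_add_of_commute]
  · congr 2
    rw [← add_smul]
    push_cast
    ring_nf
  · exact ((Commute.refl x).smul_left _).smul_right _

theorem exp_mul_exp_neg (x : Matrix (Fin n) (Fin n) ℂ) (s : ℝ) :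
    NormedSpace.exp ((Complex.I * ((-s : ℝ) : ℂ)) • x) * NormedSpace.exp ((Complex.I * (s : ℂ)) • x)
      = 1 := by
  rw [← Matrix.exp_add_of_commute, ← add_smul]
  · simp [NormedSpace.exp_zero]
  · exact ((Commute.refl x).smul_left _).smul_right _

theorem sum_mul_eigenAngle_segment_midpoint {x y : Matrix (Fin n) (Fin n) ℂ} (hx : x.IsHermitian)
    (hy : y.IsHermitian) {t s : ℝ}
    (h0 : ∀ j, |eigenAngle (segment x y t) j| < Real.pi / 2)
    (h1 : ∀ j, |eigenAngle (segment x y (t - s)) j| < Real.pi / 2)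
    (h2 : ∀ j, |eigenAngle (segment x y (t + s)) j| < Real.pi / 2)
    {u : Fin n → ℝ} (hu : Antitone u) :
    2 * ∑ j, u j * eigenAngle (segment x y t) j ≤
      ∑ j, u j * eigenAngle (segment x y (t - s)) j +
      ∑ j, u j * eigenAngle (segment x y (t + s)) j := by
  set E : ℝ → Matrix (Fin n) (Fin n) ℂ := fun s => NormedSpace.exp ((Complex.I * (s : ℂ)) • x)
  -- The factor e^{-isx} stands on the wrong side, but AB and BA have the same characteristic
  -- polynomial.
  have hang : eigenAngle (segment x y t * E (-s)) = eigenAngle (segment x y (t - s)) := by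
    apply eigenAngle_congr
    rw [Matrix.charpoly_mul_comm, exp_mul_segment, neg_add_eq_sub]
  have hprod : (segment x y t * E (-s)) * segment x y (t + s) = segment x y t * segment x y t := by
    rw [add_comm t s, ← exp_mul_segment, mul_assoc, ← mul_assoc (E (-s)), exp_mul_exp_neg, one_mul]
  have key := sum_mul_eigenAngle_mul_le (U := segment x y t * E (-s)) (V := segment x y (t + s))
    (mul_mem (segment_mem_unitary hx hy t) (exp_smul_mem_unitary hx _))
    (segment_mem_unitary hx hy _) (by rwa [hang]) h2 hu
  rw [hprod, hang, eigenAngle_mul_self (segment_mem_unitary hx hy t) h0] at key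
  refine le_trans (le_of_eq ?_) key
  rw [Finset.mul_sum]
  exact Finset.sum_congr rfl fun j _ => mul_left_comm _ _ _

theorem continuousOn_sum_mul_eigenAngle_segment {x y : Matrix (Fin n) (Fin n) ℂ}
    (hx : x.IsHermitian) (hy : y.IsHermitian) {S : Set ℝ}
    (hS : ∀ t ∈ S, ∀ j, |eigenAngle (segment x y t) j| < Real.pi / 2)
    {u : Fin n → ℝ} (hu : Antitone u) :
    ContinuousOn (fun t => ∑ j, u j * eigenAngle (segment x y t) j) S := by
  set E : ℝ → Matrix (Fin n) (Fin n) ℂ := fun s => NormedSpace.exp ((Complex.I * (s : ℂ)) • x) with hE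
  set F : ℝ → ℝ := fun t => ∑ j, u j * eigenAngle (segment x y t) j
  set K : ℝ := ∑ j, |u j| * (Real.pi / 2) with hK
  -- Subadditivity for e^{isx} u(t); used from t to t' and from t' to t, it squeezes F(t') to F(t).
  have hstep : ∀ s t, t ∈ S → ‖E s - 1‖ < √2 → F (s + t) ≤ K * ‖E s - 1‖ + F t := by
    intro s t ht hs
    have h1 := sum_mul_eigenAngle_mul_le (exp_smul_mem_unitary hx s) (segment_mem_unitary hx hy t)
      (abs_eigenAngle_lt (exp_smul_mem_unitary hx s) hs) (hS t ht) hu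
    rw [exp_mul_segment] at h1
    refine h1.trans (add_le_add_left ?_ _)
    rw [hK, Finset.sum_mul]
    refine Finset.sum_le_sum fun j _ => (le_abs_self _).trans ?_
    rw [abs_mul, mul_assoc]
    exact mul_le_mul_of_nonneg_left (abs_eigenAngle_le (exp_smul_mem_unitary hx s) j) (abs_nonneg _)
  let : NormedAlgebra ℚ (Matrix (Fin n) (Fin n) ℂ) := NormedAlgebra.restrictScalars ℚ ℂ _
  have hEc : Continuous E := NormedSpace.exp_continuous.comp (by fun_prop)
  intro t ht
  have hE0 : E 0 = 1 := by simp [hE, NormedSpace.exp_zero]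
  have l1 : Filter.Tendsto (fun t' => ‖E (t' - t) - 1‖) (nhdsWithin t S) (nhds 0) := by
    have : Continuous fun t' => ‖E (t' - t) - 1‖ := by fun_prop
    have := (this.tendsto t).mono_left (nhdsWithin_le_nhds (s := S))
    simpa [hE0] using this
  have l2 : Filter.Tendsto (fun t' => ‖E (t - t') - 1‖) (nhdsWithin t S) (nhds 0) := by
    have : Continuous fun t' => ‖E (t - t') - 1‖ := by fun_prop
    have := (this.tendsto t).mono_left (nhdsWithin_le_nhds (s := S))
    simpa [hE0] using this
  have h2 : (0 : ℝ) < √2 := by positivity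
  have e1 := l1.eventually_lt_const h2
  have e2 := l2.eventually_lt_const h2
  refine tendsto_of_tendsto_of_tendsto_of_le_of_le' (f := F)
    (g := fun t' => F t - K * ‖E (t - t') - 1‖) (h := fun t' => K * ‖E (t' - t) - 1‖ + F t) ?_ ?_ ?_ ?_
  · simpa using (l2.const_mul K).const_sub (F t)
  · simpa using (l1.const_mul K).add_const (F t)
  · filter_upwards [e2, self_mem_nhdsWithin] with t' h3 h4
    have := hstep (t - t') t' h4 h3
    rw [sub_add_cancel] at this
    linarith
  · filter_upwards [e1] with t' h3
    have := hstep (t' - t) t ht h3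
    rwa [sub_add_cancel] at this

theorem convexOn_sum_mul_eigenAngle_segment {x y : Matrix (Fin n) (Fin n) ℂ}
    (hx : x.IsHermitian) (hy : y.IsHermitian) {t₀ : ℝ}
    (h : ∀ t ∈ Set.Icc (0 : ℝ) t₀, ‖segment x y t - 1‖ < √2) {u : Fin n → ℝ} (hu : Antitone u) :
    ConvexOn ℝ (Set.Icc (0 : ℝ) t₀) fun t => ∑ j, u j * eigenAngle (segment x y t) j := by
  have hS : ∀ t ∈ Set.Icc (0 : ℝ) t₀, ∀ j, |eigenAngle (segment x y t) j| < Real.pi / 2 :=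
    fun t ht => abs_eigenAngle_lt (segment_mem_unitary hx hy t) (h t ht)
  refine convexOn_Icc_of_midpoint (continuousOn_sum_mul_eigenAngle_segment hx hy hS hu)
    fun t s h1 h2 => sum_mul_eigenAngle_segment_midpoint hx hy (hS t ?_) (hS _ h1) (hS _ h2) hu
  exact ⟨by linarith [h1.1, h2.1], by linarith [h1.2, h2.2]⟩

/-! ### Singular values as moduli of angles. -/

theorem exists_perm_antitone (f : Fin n → ℝ) : ∃ σ : Equiv.Perm (Fin n), Antitone (f ∘ σ) :=
  ⟨Tuple.sort fun j => -f j, fun _ _ hij => neg_le_neg_iff.1 (Tuple.monotone_sort (fun j => -f j) hij)⟩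

theorem singVal_antitone (A : Matrix (Fin n) (Fin n) ℂ) : Antitone (singVal A) :=
  fun _ _ h => LinearMap.singularValues_antitone _ (by exact_mod_cast h)

theorem IsEigenbasis.map_singVal {A : Matrix (Fin n) (Fin n) ℂ}
    {v : OrthonormalBasis (Fin n) ℂ (EuclideanSpace ℂ (Fin n))} {θ : Fin n → ℝ}
    (h : IsEigenbasis A v fun j => (θ j : ℂ)) :
    Finset.univ.val.map (singVal A) = Finset.univ.val.map fun j => |θ j| := by
  set T := Matrix.toEuclideanLin A
  have hn : Module.finrank ℂ (EuclideanSpace ℂ (Fin n)) = n := by simp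
  have hT : ∀ j, T (v j) = (θ j : ℂ) • v j := h
  have hadj : ∀ j, LinearMap.adjoint T (v j) = (θ j : ℂ) • v j := by
    intro j
    refine v.repr.injective (PiLp.ext fun i => ?_)
    rw [v.repr_apply_apply, v.repr_apply_apply, LinearMap.adjoint_inner_right, hT i, inner_smul_left,
      inner_smul_right, Complex.conj_ofReal, v.inner_eq_ite]
    split_ifs with hij
    · rw [hij]
    · simp
  have hcomp : ∀ j, (LinearMap.adjoint T ∘ₗ T) (v j) = ((θ j ^ 2 : ℝ) : ℂ) • v j := by
    intro j
    rw [LinearMap.comp_apply, hT j, map_smul, hadj j, smul_smul, Complex.ofReal_pow, sq]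
  have h1 := T.isSymmetric_adjoint_comp_self.roots_charpoly_eq_eigenvalues hn
  rw [charpoly_of_eigenbasis _ v _ hcomp] at h1
  have h2 := Polynomial.roots_multiset_prod_X_sub_C
    (Finset.univ.val.map fun j => ((θ j ^ 2 : ℝ) : ℂ))
  rw [Multiset.map_map] at h2
  have h3 := congrArg (Multiset.map fun z : ℂ => √z.re) (h2.symm.trans h1)
  simp only [Multiset.map_map] at h3
  refine Eq.trans ?_ (h3.symm.trans ?_)
  · refine Multiset.map_congr rfl fun j _ => ?_
    rw [singVal, LinearMap.singularValues_fin _ hn]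
    rfl
  · refine Multiset.map_congr rfl fun j _ => ?_
    simp only [Function.comp_apply, Complex.ofReal_re, Real.sqrt_sq_eq_abs]

theorem exists_perm_singVal_negILog {U : Matrix (Fin n) (Fin n) ℂ}
    (hU : U ∈ unitary (Matrix (Fin n) (Fin n) ℂ)) :
    ∃ σ : Equiv.Perm (Fin n), ∀ i, singVal (negILog U) i = |eigenAngle U (σ i)| := by
  obtain ⟨v, hv⟩ := exists_isEigenbasis_of_unitary hU
  have hN : IsStarNormal U := isStarNormal_of_mem_unitary hU
  have h1 : IsEigenbasis (negILog U) v fun j => (eigenAngle U j : ℂ) := by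
    intro j
    have hm := eigenAngle_mem U j
    rw [negILog, map_smul, LinearMap.smul_apply, cfc_apply_eigenvector U hN _ (hv j),
      Complex.log_exp (by simpa using hm.1) (by simpa using hm.2), smul_smul, mul_left_comm,
      neg_mul, Complex.I_mul_I, neg_neg, mul_one]
  obtain ⟨σ, hσ⟩ := exists_perm_antitone fun j => |eigenAngle U j|
  refine ⟨σ, fun i => congrFun (eq_of_antitone_of_map_eq (singVal_antitone _) hσ ?_) i⟩
  rw [h1.map_singVal, ← Multiset.map_map, Multiset.map_univ_val_equiv]

theorem antitone_ite_le (m : Fin n) : Antitone fun i : Fin n => if i ≤ m then (1 : ℝ) else 0 := by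
  intro i j hij
  by_cases h : j ≤ m
  · simp [h, hij.trans h]
  · simp only [h, if_false]; positivity

theorem sum_ite_le_mul (m : Fin n) (s : Fin n → ℝ) :
    ∑ i, (if i ≤ m then 1 else 0) * s i = ∑ i ∈ Finset.Iic m, s i := by
  simp [Finset.sum_ite, ← Finset.filter_ge_eq_Iic]

/-- With `exists_antitone_sum_Iic_le`, a variational formula: the sum of the m + 1 largest |θ_j|
(indices start at 0) is the maximum of ∑ u_j θ_j over nonincreasing u with values in {-1, 0, 1} and
m + 1 nonzero entries. -/
theorem sum_mul_le_sum_Iic {θ s u : Fin n → ℝ} {σ π : Equiv.Perm (Fin n)} {m : Fin n}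
    (hs : Antitone s) (hσ : ∀ i, s i = |θ (σ i)|)
    (hu : ∀ j, |u j| = if π j ≤ m then 1 else 0) :
    ∑ j, u j * θ j ≤ ∑ i ∈ Finset.Iic m, s i := by
  calc ∑ j, u j * θ j ≤ ∑ j, (if π j ≤ m then 1 else 0) * |θ j| :=
        Finset.sum_le_sum fun j _ => by rw [← hu j, ← abs_mul]; exact le_abs_self _
    _ = ∑ i, (if i ≤ m then 1 else 0) * s ((π.symm.trans σ.symm) i) := by
        rw [← Equiv.sum_comp π.symm]
        simp [hσ]
    _ ≤ ∑ i, (if i ≤ m then 1 else 0) * s i := ((antitone_ite_le m).monovary hs).sum_mul_comp_perm_le_sum_mul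
    _ = _ := sum_ite_le_mul m s

theorem exists_antitone_sum_Iic_le {θ s : Fin n → ℝ} {σ : Equiv.Perm (Fin n)} (m : Fin n)
    (hθ : Antitone θ) (hσ : ∀ i, s i = |θ (σ i)|) :
    ∃ (u : Fin n → ℝ) (π : Equiv.Perm (Fin n)), Antitone u ∧
      (∀ j, |u j| = if π j ≤ m then 1 else 0) ∧ ∑ i ∈ Finset.Iic m, s i ≤ ∑ j, u j * θ j := by
  -- The signs of θ on the indices of its largest moduli; sorting these weights can only increase
  -- the sum, since θ is sorted too.
  set w : Fin n → ℝ := fun j => (if σ.symm j ≤ m then 1 else 0) * (if 0 ≤ θ j then 1 else -1)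
  obtain ⟨τ, hτ⟩ := exists_perm_antitone w
  refine ⟨w ∘ τ, τ.trans σ.symm, hτ, fun j => ?_, ?_⟩
  · simp only [w, Function.comp_apply, abs_mul, Equiv.trans_apply]
    by_cases h1 : σ.symm (τ j) ≤ m <;> by_cases h2 : 0 ≤ θ (τ j) <;> simp [h1, h2]
  · calc ∑ i ∈ Finset.Iic m, s i = ∑ i, (if i ≤ m then 1 else 0) * s i := (sum_ite_le_mul m s).symm
      _ = ∑ j, w j * θ j := by
          rw [← Equiv.sum_comp σ fun j => w j * θ j]
          refine Finset.sum_congr rfl fun i _ => ?_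
          simp only [w, hσ, Equiv.symm_apply_apply, mul_assoc]
          congr 1
          split_ifs with h
          · rw [abs_of_nonneg h, one_mul]
          · rw [abs_of_neg (not_le.1 h), neg_one_mul]
      _ = ∑ j, (w ∘ τ) j * θ (τ j) := (Equiv.sum_comp τ fun j => w j * θ j).symm
      _ ≤ _ := (hτ.monovary hθ).sum_mul_comp_perm_le_sum_mul

theorem convexOn_sum_singVal_segment {x y : Matrix (Fin n) (Fin n) ℂ}
    (hx : x.IsHermitian) (hy : y.IsHermitian) {t₀ : ℝ}
    (h : ∀ t ∈ Set.Icc (0 : ℝ) t₀, ‖segment x y t - 1‖ < √2) (m : Fin n) :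
    ConvexOn ℝ (Set.Icc (0 : ℝ) t₀)
      fun t => ∑ i ∈ Finset.Iic m, singVal (negILog (segment x y t)) i := by
  refine ⟨convex_Icc _ _, fun a ha b hb p q hp hq hpq => ?_⟩
  obtain ⟨σ, hσ⟩ := exists_perm_singVal_negILog (segment_mem_unitary hx hy (p • a + q • b))
  -- Weights optimal at the intermediate point remain admissible at the endpoints: a maximum of
  -- convex functions is convex.
  obtain ⟨u, π, hu, hπ, hle⟩ := exists_antitone_sum_Iic_le m (eigenAngle_antitone _) hσ
  refine hle.trans (((convexOn_sum_mul_eigenAngle_segment hx hy h hu).2 ha hb hp hq hpq).trans ?_)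
  have hbound : ∀ t, ∑ j, u j * eigenAngle (segment x y t) j ≤
      ∑ i ∈ Finset.Iic m, singVal (negILog (segment x y t)) i := by
    intro t
    obtain ⟨ρ, hρ⟩ := exists_perm_singVal_negILog (segment_mem_unitary hx hy t)
    exact sum_mul_le_sum_Iic (singVal_antitone _) hρ hπ
  exact add_le_add (smul_le_smul_of_nonneg_left (hbound a) hp)
    (smul_le_smul_of_nonneg_left (hbound b) hq)

theorem convexOn_sum_eigenAngle_Iic {x y : Matrix (Fin n) (Fin n) ℂ}
    (hx : x.IsHermitian) (hy : y.IsHermitian) {t₀ : ℝ}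
    (h : ∀ t ∈ Set.Icc (0 : ℝ) t₀, ‖segment x y t - 1‖ < √2) (m : Fin n) :
    ConvexOn ℝ (Set.Icc (0 : ℝ) t₀)
      fun t => ∑ i ∈ Finset.Iic m, eigenAngle (segment x y t) i := by
  convert! convexOn_sum_mul_eigenAngle_segment hx hy h (antitone_ite_le m) using 2
  rw [sum_ite_le_mul]

theorem concaveOn_sum_eigenAngle_Ici {x y : Matrix (Fin n) (Fin n) ℂ}
    (hx : x.IsHermitian) (hy : y.IsHermitian) {t₀ : ℝ}
    (h : ∀ t ∈ Set.Icc (0 : ℝ) t₀, ‖segment x y t - 1‖ < √2) (m : Fin n) :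
    ConcaveOn ℝ (Set.Icc (0 : ℝ) t₀)
      fun t => ∑ i ∈ Finset.Ici m, eigenAngle (segment x y t) i := by
  have hind : Antitone fun i : Fin n => if m ≤ i then (-1 : ℝ) else 0 := by
    intro i j hij
    by_cases h : m ≤ i
    · simp [h, h.trans hij]
    · simp only [h, if_false]; split_ifs <;> norm_num
  rw [← neg_convexOn_iff]
  convert! convexOn_sum_mul_eigenAngle_segment hx hy h hind using 2
  simp [Finset.sum_ite, ← Finset.filter_le_eq_Ici]

/-! ### Optimality of √2 in dimension two. -/

theorem eigenAngle_fin_two {U : Matrix (Fin 2) (Fin 2) ℂ} {γ : ℝ} (hdet : U.det = 1)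
    (htr : U.trace = ((2 * Real.cos γ : ℝ) : ℂ)) (h0 : 0 ≤ γ) (hγ : γ < Real.pi) :
    eigenAngle U = ![γ, -γ] := by
  have hcp : U.charpoly = (Multiset.map (fun z => Polynomial.X - Polynomial.C z)
      {Complex.exp (γ * Complex.I), Complex.exp (((-γ : ℝ) : ℂ) * Complex.I)}).prod := by
    have h1 : Complex.exp (γ * Complex.I) + Complex.exp (((-γ : ℝ) : ℂ) * Complex.I) =
        ((2 * Real.cos γ : ℝ) : ℂ) := by
      push_cast
      rw [Complex.cos]
      ring_nf
    have h2 : Complex.exp (γ * Complex.I) * Complex.exp (((-γ : ℝ) : ℂ) * Complex.I) = 1 := by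
      rw [← Complex.exp_add]
      simp
    rw [Matrix.charpoly_fin_two, htr, hdet, ← h1, ← h2]
    simp only [Multiset.insert_eq_cons, Multiset.map_cons, Multiset.map_singleton,
      Multiset.prod_cons, Multiset.prod_singleton, map_add, map_mul]
    ring
  refine eq_of_antitone_of_map_eq (eigenAngle_antitone U) ?_ ?_
  · intro i j hij
    fin_cases i <;> fin_cases j <;> simp at hij ⊢ <;> linarith
  · rw [map_eigenAngle, hcp, Polynomial.roots_multiset_prod_X_sub_C]
    simp only [Multiset.insert_eq_cons, Multiset.map_cons, Multiset.map_singleton,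
      Complex.arg_exp_mul_I]
    rw [toIocMod_eq_self _ |>.2 ⟨by linarith, by linarith⟩,
      toIocMod_eq_self _ |>.2 ⟨by linarith, by linarith⟩]
    simp [Fin.univ_val_map]
    rfl

/-- In SU(2) the adjoint is the adjugate, so U + U* = (tr U)·1 and (U - 1)*(U - 1) is scalar. -/
theorem norm_sub_one_sq_fin_two {U : Matrix (Fin 2) (Fin 2) ℂ}
    (hU : U ∈ unitary (Matrix (Fin 2) (Fin 2) ℂ)) {c : ℝ} (hdet : U.det = 1)
    (htr : U.trace = ((2 * c : ℝ) : ℂ)) : ‖U - 1‖ ^ 2 = |2 - 2 * c| := by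
  have hadj : star U = U.adjugate := by
    have h1 : U * U.adjugate = 1 := by rw [Matrix.mul_adjugate, hdet, one_smul]
    calc star U = star U * (U * U.adjugate) := by rw [h1, mul_one]
      _ = U.adjugate := by rw [← mul_assoc, Unitary.star_mul_self_of_mem hU, one_mul]
  have hsum : U + star U = ((2 * c : ℝ) : ℂ) • (1 : Matrix (Fin 2) (Fin 2) ℂ) := by
    rw [hadj, ← htr, Matrix.adjugate_fin_two, Matrix.trace_fin_two]
    ext i j
    fin_cases i <;> fin_cases j <;> simp [add_comm]
  have h2 : star (U - 1) * (U - 1) = ((2 - 2 * c : ℝ) : ℂ) • (1 : Matrix (Fin 2) (Fin 2) ℂ) := by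
    rw [star_sub, star_one, sub_mul, mul_sub, Unitary.star_mul_self_of_mem hU, one_mul, mul_one,
      Complex.ofReal_sub, sub_smul, ← hsum]
    rw [show ((2 : ℝ) : ℂ) • (1 : Matrix (Fin 2) (Fin 2) ℂ) = 1 + 1 by
      rw [Complex.ofReal_ofNat, two_smul]]
    abel
  rw [sq, ← CStarRing.norm_star_mul_self, h2, norm_smul, norm_one, mul_one, Complex.norm_real,
    Real.norm_eq_abs]

theorem segment_diagonal_antidiagonal (b t : ℝ) :
    segment !![1, 0; 0, -1] ((b : ℂ) • !![0, 1; 1, 0]) t =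
      !![Complex.exp (t * Complex.I) * Complex.cos b,
          Complex.exp (t * Complex.I) * (Complex.I * Complex.sin b);
        Complex.exp (-(t * Complex.I)) * (Complex.I * Complex.sin b),
          Complex.exp (-(t * Complex.I)) * Complex.cos b] := by
  have h1 : NormedSpace.exp ((Complex.I * (t : ℂ)) • (!![1, 0; 0, -1] : Matrix (Fin 2) (Fin 2) ℂ)) =
      !![Complex.exp (t * Complex.I), 0; 0, Complex.exp (-(t * Complex.I))] := by
    have e : (Complex.I * (t : ℂ)) • (!![1, 0; 0, -1] : Matrix (Fin 2) (Fin 2) ℂ) =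
        Matrix.diagonal ![t * Complex.I, -(t * Complex.I)] := by
      ext i j
      fin_cases i <;> fin_cases j <;> simp [mul_comm]
    rw [e, Matrix.exp_diagonal]
    ext i j
    fin_cases i <;> fin_cases j <;> simp [Pi.exp_def, Complex.exp_eq_exp_ℂ]
  have h2 : NormedSpace.exp (Complex.I • ((b : ℂ) • (!![0, 1; 1, 0] : Matrix (Fin 2) (Fin 2) ℂ))) =
      !![Complex.cos b, Complex.I * Complex.sin b; Complex.I * Complex.sin b, Complex.cos b] := by
    -- The columns of Q are eigenvectors of the flip, for 1 and -1.
    set Q : Matrix (Fin 2) (Fin 2) ℂ := !![1, 1; 1, -1] with hQ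
    have hQQ : Q * ((1 / 2 : ℂ) • Q) = 1 := by
      ext i j
      fin_cases i <;> fin_cases j <;> simp [hQ, Matrix.mul_apply] <;> norm_num
    have hinv : Q⁻¹ = (1 / 2 : ℂ) • Q := Matrix.inv_eq_right_inv hQQ
    have hunit : IsUnit Q := (Matrix.isUnit_iff_isUnit_det _).2 (by simp [hQ]; norm_num)
    have e : Complex.I • ((b : ℂ) • (!![0, 1; 1, 0] : Matrix (Fin 2) (Fin 2) ℂ)) =
        Q * Matrix.diagonal ![b * Complex.I, -(b * Complex.I)] * Q⁻¹ := by
      rw [hinv]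
      ext i j
      fin_cases i <;> fin_cases j <;> simp [hQ, Matrix.mul_apply, Matrix.vecMul_diagonal] <;> ring
    rw [e, Matrix.exp_conj _ _ hunit, Matrix.exp_diagonal, hinv]
    have hexp : NormedSpace.exp ![(b : ℂ) * Complex.I, -(b * Complex.I)] =
        ![Complex.exp (b * Complex.I), Complex.exp (-(b * Complex.I))] := by
      ext i
      fin_cases i <;> simp [Complex.exp_eq_exp_ℂ]
    rw [hexp]
    have hs : Complex.I * Complex.sin b =
        (Complex.exp (b * Complex.I) - Complex.exp (-(b * Complex.I))) / 2 := by
      rw [Complex.sin, ← neg_mul]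
      linear_combination ((Complex.exp (-b * Complex.I) - Complex.exp (b * Complex.I)) / 2) *
        Complex.I_mul_I
    rw [hs, Complex.cos, ← neg_mul]
    ext i j
    fin_cases i <;> fin_cases j <;> simp [hQ, Matrix.mul_apply, Matrix.vecMul_diagonal] <;> ring
  rw [segment, h1, h2]
  ext i j
  fin_cases i <;> fin_cases j <;> simp [Matrix.mul_apply]

/-- The midpoint test fails: the values at 0 and π/2 average to a/2 + π/2 = arccos(-sin(a/2)), while
sin a / √2 > sin(a/2) makes the value at π/4 larger. -/
theorem not_convexOn_arccos {a : ℝ} (h0 : 0 < a) (ha : a < Real.pi / 2) :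
    ¬ ConvexOn ℝ (Set.Icc (0 : ℝ) (Real.pi / 2))
      fun t => Real.arccos (-(Real.cos t * Real.sin a)) := by
  intro h
  have hpi := Real.pi_pos
  have h1 := h.2 (Set.left_mem_Icc.2 (by positivity)) (Set.right_mem_Icc.2 (by positivity))
    (show (0 : ℝ) ≤ 1 / 2 by norm_num) (show (0 : ℝ) ≤ 1 / 2 by norm_num) (by norm_num)
  simp only [smul_eq_mul, mul_zero, zero_add, Real.cos_zero, one_mul, Real.cos_pi_div_two, zero_mul,
    neg_zero, Real.arccos_zero] at h1
  rw [show 1 / 2 * (Real.pi / 2) = Real.pi / 4 by ring, Real.cos_pi_div_four,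
    ← Real.cos_add_pi_div_two, Real.arccos_cos (by linarith) (by linarith)] at h1
  have h2 : Real.arccos (Real.cos (a / 2 + Real.pi / 2)) = a / 2 + Real.pi / 2 :=
    Real.arccos_cos (by linarith) (by linarith)
  rw [Real.cos_add_pi_div_two] at h2
  have hs : 0 < Real.sin (a / 2) := Real.sin_pos_of_pos_of_lt_pi (by linarith) (by linarith)
  have hc : √2 / 2 < Real.cos (a / 2) := by
    rw [← Real.cos_pi_div_four]
    exact Real.cos_lt_cos_of_nonneg_of_le_pi (by linarith) (by linarith) (by linarith)
  have hsin : Real.sin a = 2 * Real.sin (a / 2) * Real.cos (a / 2) := by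
    rw [← Real.sin_two_mul]
    ring_nf
  have hsq : √2 * √2 = 2 := Real.mul_self_sqrt (by norm_num)
  have hs2 : 0 < √2 := by positivity
  have h3 : -(√2 / 2 * Real.sin a) < -Real.sin (a / 2) := by
    rw [hsin]
    have : 1 < √2 * Real.cos (a / 2) := by nlinarith
    nlinarith
  have h4 := Real.arccos_lt_arccos (x := -(√2 / 2 * Real.sin a)) (y := -Real.sin (a / 2))
    (by nlinarith [Real.sin_le_one a, Real.sin_pos_of_pos_of_lt_pi h0 (by linarith)]) h3
    (by linarith)
  linarith

theorem exists_segment_not_convexOn {r : ℝ} (hr : √2 < r) :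
    ∃ (x y : Matrix (Fin 2) (Fin 2) ℂ) (t₀ : ℝ),
      x.IsHermitian ∧ y.IsHermitian ∧ 0 < t₀ ∧
      (∀ t ∈ Set.Icc (0 : ℝ) t₀, ‖segment x y t - 1‖ < r) ∧
      ¬ ConvexOn ℝ (Set.Icc (0 : ℝ) t₀) (fun t => eigenAngle (segment x y t) 0) ∧
      ¬ ConcaveOn ℝ (Set.Icc (0 : ℝ) t₀) (fun t => eigenAngle (segment x y t) 1) ∧
      ¬ ConvexOn ℝ (Set.Icc (0 : ℝ) t₀) (fun t => singVal (negILog (segment x y t)) 0) := by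
  have hpi := Real.pi_pos
  have hr2 : 2 < r ^ 2 := by
    have := pow_lt_pow_left₀ hr (by positivity) two_ne_zero
    rwa [Real.sq_sqrt (by norm_num)] at this
  -- On the path below ‖u(t) - 1‖² = 2 + 2 cos t sin a, largest at t = 0, where the angle a + π/2
  -- lies just beyond the critical π/2 for small a.
  obtain ⟨a, har, ha0, ha⟩ : ∃ a : ℝ, 2 + 2 * Real.sin a < r ^ 2 ∧ a ∈ Set.Ioo 0 (Real.pi / 2) := by
    have hc : Continuous fun a : ℝ => 2 + 2 * Real.sin a := by fun_prop
    have h1 := ((hc.tendsto 0).mono_left (nhdsWithin_le_nhds (s := Set.Ioi 0))).eventually_lt_const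
      (show 2 + 2 * Real.sin 0 < r ^ 2 by simpa using hr2)
    exact (h1.and (Ioo_mem_nhdsGT (by positivity))).exists
  have hsa : 0 < Real.sin a := Real.sin_pos_of_pos_of_lt_pi ha0 (by linarith)
  have hsa1 : Real.sin a < 1 := by
    rw [← Real.sin_pi_div_two]
    exact Real.sin_lt_sin_of_lt_of_le_pi_div_two (by linarith) le_rfl ha
  set x : Matrix (Fin 2) (Fin 2) ℂ := !![1, 0; 0, -1] with hx
  set y : Matrix (Fin 2) (Fin 2) ℂ := ((a + Real.pi / 2 : ℝ) : ℂ) • !![0, 1; 1, 0] with hy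
  have hxH : x.IsHermitian := by
    ext i j
    fin_cases i <;> fin_cases j <;> simp [hx]
  have hyH : y.IsHermitian := by
    ext i j
    fin_cases i <;> fin_cases j <;> simp [hy]
  set f : ℝ → ℝ := fun t => Real.arccos (-(Real.cos t * Real.sin a)) with hf
  have habs : ∀ t, |Real.cos t * Real.sin a| < 1 := fun t => by
    rw [abs_mul, abs_of_pos hsa]
    nlinarith [Real.abs_cos_le_one t, abs_nonneg (Real.cos t)]
  have hdet : ∀ t, (segment x y t).det = 1 := fun t => by
    rw [segment_diagonal_antidiagonal, Matrix.det_fin_two_of]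
    have e := Complex.sin_sq_add_cos_sq ((a + Real.pi / 2 : ℝ) : ℂ)
    have e2 : Complex.exp (t * Complex.I) * Complex.exp (-(t * Complex.I)) = 1 := by
      rw [← Complex.exp_add, add_neg_cancel, Complex.exp_zero]
    linear_combination (Complex.cos ((a + Real.pi / 2 : ℝ) : ℂ) ^ 2 -
      Complex.I ^ 2 * Complex.sin ((a + Real.pi / 2 : ℝ) : ℂ) ^ 2) * e2 + e -
      Complex.sin ((a + Real.pi / 2 : ℝ) : ℂ) ^ 2 * Complex.I_sq
  have htr : ∀ t, (segment x y t).trace = ((2 * (-(Real.cos t * Real.sin a)) : ℝ) : ℂ) := fun t => by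
    rw [segment_diagonal_antidiagonal, Matrix.trace_fin_two_of, ← Complex.ofReal_cos,
      Real.cos_add_pi_div_two]
    push_cast
    rw [Complex.cos, ← neg_mul]
    ring
  have hang : ∀ t, eigenAngle (segment x y t) = ![f t, -f t] := fun t => by
    have := abs_lt.1 (habs t)
    refine eigenAngle_fin_two (hdet t) ?_ (Real.arccos_nonneg _) ?_
    · rw [htr t, hf, Real.cos_arccos (by linarith) (by linarith)]
    · exact Real.arccos_lt_pi.2 (by linarith)
  have hnc := not_convexOn_arccos ha0 ha
  refine ⟨x, y, Real.pi / 2, hxH, hyH, by positivity, fun t ht => ?_, ?_, ?_, ?_⟩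
  · have h1 := norm_sub_one_sq_fin_two (segment_mem_unitary hxH hyH t) (hdet t) (htr t)
    have h2 := abs_lt.1 (habs t)
    rw [abs_of_nonneg (by linarith)] at h1
    refine lt_of_pow_lt_pow_left₀ 2 ((Real.sqrt_nonneg 2).trans hr.le) ?_
    rw [h1]
    nlinarith [Real.cos_le_one t]
  · simpa only [hang, Matrix.cons_val_zero] using hnc
  · simp only [hang, Matrix.cons_val_one, Matrix.cons_val_fin_one]
    intro h
    exact hnc (neg_concaveOn_iff.1 h)
  · have hs : ∀ t, singVal (negILog (segment x y t)) 0 = f t := fun t => by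
      obtain ⟨σ, hσ⟩ := exists_perm_singVal_negILog (segment_mem_unitary hxH hyH t)
      have hf0 : |f t| = f t := abs_of_nonneg (Real.arccos_nonneg _)
      rw [hσ, hang]
      generalize σ 0 = k
      fin_cases k <;> simp [hf0]
    simpa only [hs] using hnc

end UnitarySegment

end

theorem theorem3p5 :
    (∀ (n : ℕ) (x y : Matrix (Fin n) (Fin n) ℂ) (t₀ : ℝ),
      x.IsHermitian → y.IsHermitian →
      (∀ t ∈ Set.Icc (0 : ℝ) t₀, ‖UnitarySegment.segment x y t - 1‖ < √2) →
      ∀ m : Fin n,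
        ConvexOn ℝ (Set.Icc (0 : ℝ) t₀)
          (fun t => ∑ i ∈ Finset.Iic m,
            UnitarySegment.eigenAngle (UnitarySegment.segment x y t) i) ∧
        ConcaveOn ℝ (Set.Icc (0 : ℝ) t₀)
          (fun t => ∑ i ∈ Finset.Ici m,
            UnitarySegment.eigenAngle (UnitarySegment.segment x y t) i) ∧
        ConvexOn ℝ (Set.Icc (0 : ℝ) t₀)
          (fun t => ∑ i ∈ Finset.Iic m,
            UnitarySegment.singVal
              (UnitarySegment.negILog (UnitarySegment.segment x y t)) i)) ∧
    (∀ r : ℝ, √2 < r →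
      ∃ (x y : Matrix (Fin 2) (Fin 2) ℂ) (t₀ : ℝ),
        x.IsHermitian ∧ y.IsHermitian ∧ 0 < t₀ ∧
        (∀ t ∈ Set.Icc (0 : ℝ) t₀, ‖UnitarySegment.segment x y t - 1‖ < r) ∧
        ¬ ConvexOn ℝ (Set.Icc (0 : ℝ) t₀)
          (fun t => UnitarySegment.eigenAngle (UnitarySegment.segment x y t) 0) ∧
        ¬ ConcaveOn ℝ (Set.Icc (0 : ℝ) t₀)
          (fun t => UnitarySegment.eigenAngle (UnitarySegment.segment x y t) 1) ∧
        ¬ ConvexOn ℝ (Set.Icc (0 : ℝ) t₀)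
          (fun t => UnitarySegment.singVal
            (UnitarySegment.negILog (UnitarySegment.segment x y t)) 0)) :=
  ⟨fun _ _ _ _ hx hy h m =>
    ⟨UnitarySegment.convexOn_sum_eigenAngle_Iic hx hy h m,
      UnitarySegment.concaveOn_sum_eigenAngle_Ici hx hy h m,
      UnitarySegment.convexOn_sum_singVal_segment hx hy h m⟩,
    fun _ hr => UnitarySegment.exists_segment_not_convexOn hr⟩
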